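/- For $n\ge 3$, let $AN_n$ be the alternating group network: the simple graph whose vertices are the even permutations $p=p_1p_2\cdots p_n$ of $\{1,\dots,n\}$, where $p$ and $q$ are adjacent if and only if one of the following holds: (i) $p_1=q_2$, $p_2=q_3$, $p_3=q_1$, and $p_j=q_j$ for all $j\notin\{1,2,3\}$; (ii) $p_1=q_3$, $p_2=q_1$, $p_3=q_2$, and $p_j=q_j$ for all $j\notin\{1,2,3\}$; (iii) there is $i\in\{4,\dots,n\}$ such that $p_1=q_2$, $p_2=q_1$, $p_3=q_i$, $p_i=q_3$, and $p_j=q_j$ for all $j\notin\{1,2,3,i\}$. For a finite graph $G$ and an integer $\ell\ge 2$, let $\kappa_\ell(G)$ be the minimum number of vertices whose removal from $G$ results in a disconnected graph with at least $\ell$ connected components or in a graph with fewer than $\ell$ vertices. Lemma. For every $n\ge 6$, $\kappa_4(AN_n)\ge 3n-6$. Equivalently, for every set $F$ of vertices of $AN_n$ with $|F|\le 3n-7$, the graph $AN_n-F$ has at most three connected components. -/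

import Mathlib

/-- `RemovalLeaves G ℓ F`: deleting the vertex set `F` from `G` leaves either a disconnected graph
with at least `ℓ` connected components, or a graph with fewer than `ℓ` vertices. -/
def RemovalLeaves {V : Type*} (G : SimpleGraph V) (ℓ : ℕ) (F : Finset V) : Prop :=
  (¬ (G.induce {v : V | v ∉ F}).Connected ∧
      ℓ ≤ Nat.card (G.induce {v : V | v ∉ F}).ConnectedComponent) ∨
    Nat.card {v : V | v ∉ F} < ℓ

/-- The `ℓ`-component connectivity `κ_ℓ(G)` of a finite graph (for `ℓ ≥ 2`): the minimum number of
vertices whose removal leaves a disconnected graph with at least `ℓ` components or a graph with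
fewer than `ℓ` vertices. -/
noncomputable def componentConnectivity {V : Type*} [Finite V] (ℓ : ℕ) (G : SimpleGraph V) : ℕ :=
  sInf {k : ℕ | ∃ F : Finset V, F.card = k ∧ RemovalLeaves G ℓ F}

/-- The minimum defining `componentConnectivity` is over a nonempty set, hence is attained. -/
theorem componentConnectivity_attained {V : Type*} [Finite V] {ℓ : ℕ} (hℓ : 2 ≤ ℓ)
    (G : SimpleGraph V) :
    ∃ F : Finset V, F.card = componentConnectivity ℓ G ∧ RemovalLeaves G ℓ F := by
  classical
  have := Fintype.ofFinite V
  have h : {k : ℕ | ∃ F : Finset V, F.card = k ∧ RemovalLeaves G ℓ F}.Nonempty := by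
    refine ⟨_, Finset.univ, rfl, Or.inr ?_⟩
    have : IsEmpty {v : V | v ∉ (Finset.univ : Finset V)} := ⟨fun v => v.2 (Finset.mem_univ _)⟩
    rw [Nat.card_of_isEmpty]
    omega
  exact Nat.sInf_mem h

/-- The alternating group network `AN_n` (`n ≥ 3`). Its vertices are the even permutations of `n`
symbols; the permutation `p` is the word `p_1 p_2 ⋯ p_n`, whose symbol `p_j` in position `j` is
`p (j - 1)` for the zero-based index `j - 1 : Fin n`. -/
def alternatingGroupNetwork (n : ℕ) (hn : 3 ≤ n) : SimpleGraph (alternatingGroup (Fin n)) where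
  Adj p q :=
    let x₁ : Fin n := ⟨0, by omega⟩
    let x₂ : Fin n := ⟨1, by omega⟩
    let x₃ : Fin n := ⟨2, by omega⟩
    (p.1 x₁ = q.1 x₂ ∧ p.1 x₂ = q.1 x₃ ∧ p.1 x₃ = q.1 x₁ ∧
      ∀ j, j ≠ x₁ → j ≠ x₂ → j ≠ x₃ → p.1 j = q.1 j) ∨
    (p.1 x₁ = q.1 x₃ ∧ p.1 x₂ = q.1 x₁ ∧ p.1 x₃ = q.1 x₂ ∧
      ∀ j, j ≠ x₁ → j ≠ x₂ → j ≠ x₃ → p.1 j = q.1 j) ∨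
    (∃ i, i ≠ x₁ ∧ i ≠ x₂ ∧ i ≠ x₃ ∧
      p.1 x₁ = q.1 x₂ ∧ p.1 x₂ = q.1 x₁ ∧ p.1 x₃ = q.1 i ∧ p.1 i = q.1 x₃ ∧
      ∀ j, j ≠ x₁ → j ≠ x₂ → j ≠ x₃ → j ≠ i → p.1 j = q.1 j)
  symm := ⟨by
    rintro p q (⟨h1, h2, h3, h⟩ | ⟨h1, h2, h3, h⟩ | ⟨i, i1, i2, i3, h1, h2, h3, h4, h⟩)
    · exact Or.inr (Or.inl ⟨h3.symm, h1.symm, h2.symm, fun j a b c => (h j a b c).symm⟩)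
    · exact Or.inl ⟨h2.symm, h3.symm, h1.symm, fun j a b c => (h j a b c).symm⟩
    · exact Or.inr (Or.inr ⟨i, i1, i2, i3, h2.symm, h1.symm, h4.symm, h3.symm,
        fun j a b c d => (h j a b c d).symm⟩)⟩
  loopless := ⟨by
    rintro p (⟨h1, -⟩ | ⟨h1, -⟩ | ⟨i, -, -, -, h1, -⟩) <;>
    · have := congrArg Fin.val (p.1.injective h1)
      simp at this⟩

/-! Fix a position `s` outside the leading three and sort vertices by the symbol there. Each of the
`n` classes is a copy of the network of dimension `n - 1`, and right multiplication by `gen hn s`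
matches every vertex with one in another class, exchanging the symbols in position `s` and in the
third position.

A class stays connected after `n - 3` deletions (`linked_of_card_filter_le`, by induction on
dimension). Any two classes are joined by at least `3n - 6` matching edges, more than `3n - 7`
deletions can destroy, so all surviving vertices of sparse classes lie in one component
(`linked_of_sparse`). Since `3(n - 2) > 3n - 7`, at most two classes are not sparse.

It remains to exclude three further components, with representatives `a`, `b`, `c`
(`card_ge_of_stuck`). The closed neighbourhood of each within its class has `n - 1` vertices, with
distinct symbols in third position. If that symbol names a sparse class, then the vertex or its
partner is deleted. Unlinked vertices share at most one neighbour (`gen_quotient`,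
`card_ball_inter_le`), so the neighbourhoods are nearly disjoint, and counting one deletion per
matching edge gives `|F| ≥ 3n - 6`. -/

open Equiv

/-! ### Reachability after deleting vertices -/

/-- `p` and `q` survive the deletion of `F` and lie in the same component. -/
def Linked {V : Type*} (G : SimpleGraph V) (F : Finset V) (p q : V) : Prop :=
  ∃ (hp : p ∉ F) (hq : q ∉ F), (G.induce {v : V | v ∉ F}).Reachable ⟨p, hp⟩ ⟨q, hq⟩

namespace Linked

variable {V : Type*} {G : SimpleGraph V} {F : Finset V} {p q r : V}

theorem refl (hp : p ∉ F) : Linked G F p p := ⟨hp, hp, SimpleGraph.Reachable.refl _⟩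

theorem symm (h : Linked G F p q) : Linked G F q p := ⟨h.2.1, h.1, h.2.2.symm⟩

theorem trans (h : Linked G F p q) (h' : Linked G F q r) : Linked G F p r :=
  ⟨h.1, h'.2.1, h.2.2.trans h'.2.2⟩

theorem of_adj (hp : p ∉ F) (hq : q ∉ F) (h : G.Adj p q) : Linked G F p q :=
  ⟨hp, hq, SimpleGraph.Adj.reachable (by simpa using h)⟩

end Linked

/-! ### The generators -/

namespace AlternatingNetwork

variable {n : ℕ}

/-- The first position. -/
def fst (hn : 3 ≤ n) : Fin n := ⟨0, by omega⟩
/-- The second position. -/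
def snd (hn : 3 ≤ n) : Fin n := ⟨1, by omega⟩
/-- The third position. -/
def trd (hn : 3 ≤ n) : Fin n := ⟨2, by omega⟩

theorem fst_ne_snd (hn : 3 ≤ n) : fst hn ≠ snd hn := by simp [fst, snd]
theorem fst_ne_trd (hn : 3 ≤ n) : fst hn ≠ trd hn := by simp [fst, trd]
theorem snd_ne_trd (hn : 3 ≤ n) : snd hn ≠ trd hn := by simp [snd, trd]

/-- The three leading positions. -/
def lead (hn : 3 ≤ n) : Finset (Fin n) := {fst hn, snd hn, trd hn}

theorem mem_lead {hn : 3 ≤ n} {j : Fin n} :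
    j ∈ lead hn ↔ j = fst hn ∨ j = snd hn ∨ j = trd hn := by simp [lead]

theorem card_lead (hn : 3 ≤ n) : (lead hn).card = 3 :=
  Finset.card_eq_three.2 ⟨_, _, _, fst_ne_snd hn, fst_ne_trd hn, snd_ne_trd hn, rfl⟩

/-- The position permutation whose right multiplication moves the symbol in position `t` to the
third position along an edge of the network (the identity for `t` the third position). -/
def genPerm (hn : 3 ≤ n) (t : Fin n) : Perm (Fin n) :=
  if t = trd hn then 1
  else if t = fst hn then swap (fst hn) (snd hn) * swap (snd hn) (trd hn)
  else if t = snd hn then swap (fst hn) (snd hn) * swap (fst hn) (trd hn)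
  else swap (fst hn) (snd hn) * swap (trd hn) t

theorem sign_genPerm (hn : 3 ≤ n) (t : Fin n) : Perm.sign (genPerm hn t) = 1 := by
  have h1 := fst_ne_snd hn
  have h2 := fst_ne_trd hn
  have h3 := snd_ne_trd hn
  unfold genPerm
  split_ifs with h h' h'' <;> simp [*]
  exact Ne.symm h

/-- `genPerm` as an element of the alternating group. -/
def gen (hn : 3 ≤ n) (t : Fin n) : alternatingGroup (Fin n) :=
  ⟨genPerm hn t, Perm.mem_alternatingGroup.2 (sign_genPerm hn t)⟩

theorem gen_trd (hn : 3 ≤ n) : gen hn (trd hn) = 1 := Subtype.ext (by simp [gen, genPerm])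

theorem gen_apply (hn : 3 ≤ n) (t j : Fin n) :
    (gen hn t).1 j =
      if t = trd hn then j
      else if t = fst hn then
        if j = fst hn then snd hn else if j = snd hn then trd hn
        else if j = trd hn then fst hn else j
      else if t = snd hn then
        if j = fst hn then trd hn else if j = snd hn then fst hn
        else if j = trd hn then snd hn else j
      else
        if j = fst hn then snd hn else if j = snd hn then fst hn
        else if j = trd hn then t else if j = t then trd hn else j := by
  have h1 := fst_ne_snd hn
  have h2 := fst_ne_trd hn
  have h3 := snd_ne_trd hn
  simp only [gen, genPerm]
  split_ifs <;> simp only [Perm.coe_mul, Perm.coe_one, id, Function.comp, swap_apply_def] <;> grind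

theorem gen_apply_trd (hn : 3 ≤ n) (t : Fin n) : (gen hn t).1 (trd hn) = t := by
  have h1 := fst_ne_snd hn
  have h2 := fst_ne_trd hn
  have h3 := snd_ne_trd hn
  rw [gen_apply]; grind

theorem gen_apply_self {hn : 3 ≤ n} {s : Fin n} (hs : s ∉ lead hn) :
    (gen hn s).1 s = trd hn := by
  rw [mem_lead] at hs
  rw [gen_apply]; grind

theorem gen_apply_of_ne {hn : 3 ≤ n} {t j : Fin n} (hj : j ∉ lead hn) (h : j ≠ t) :
    (gen hn t).1 j = j := by
  rw [mem_lead] at hj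
  rw [gen_apply]; grind

theorem gen_mul_self {hn : 3 ≤ n} {s : Fin n} (hs : s ∉ lead hn) : gen hn s * gen hn s = 1 := by
  rw [mem_lead] at hs
  have h1 := fst_ne_snd hn
  have h2 := fst_ne_trd hn
  have h3 := snd_ne_trd hn
  ext j : 2
  simp only [Subgroup.coe_mul, Perm.coe_mul, Function.comp, Subgroup.coe_one, Perm.coe_one, id]
  simp only [gen_apply]; grind

/-- Two generators either differ by a generator, or satisfy a relation which determines the first
of them from their quotient. -/
theorem gen_quotient (hn : 3 ≤ n) (t u : Fin n) :
    (∃ v, gen hn t = gen hn v * gen hn u) ∨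
      ∃ j, (gen hn u).1 j = t ∧ (gen hn t).1 j = trd hn := by
  have h1 := fst_ne_snd hn
  have h2 := fst_ne_trd hn
  have h3 := snd_ne_trd hn
  by_cases htu : t = u
  · exact Or.inl ⟨trd hn, by rw [gen_trd, one_mul, htu]⟩
  by_cases hu : u = trd hn
  · exact Or.inl ⟨t, by rw [hu, gen_trd, mul_one]⟩
  have key : ∀ v, (∀ j, (gen hn t).1 j = (gen hn v).1 ((gen hn u).1 j)) →
      gen hn t = gen hn v * gen hn u := fun v h => Subtype.ext (Perm.ext h)
  by_cases ht : t = trd hn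
  · by_cases hu1 : u = fst hn
    · refine Or.inl ⟨snd hn, key _ fun j => ?_⟩
      simp only [gen_apply]; grind
    by_cases hu2 : u = snd hn
    · refine Or.inl ⟨fst hn, key _ fun j => ?_⟩
      simp only [gen_apply]; grind
    · refine Or.inl ⟨u, key _ fun j => ?_⟩
      simp only [gen_apply]; grind
  by_cases ht1 : t = fst hn
  · by_cases hu2 : u = snd hn
    · refine Or.inl ⟨snd hn, key _ fun j => ?_⟩
      simp only [gen_apply]; grind
    -- Here `u` is not a leading position, so `gen hn u` exchanges the first two positions.
    · refine Or.inr ⟨snd hn, ?_⟩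
      simp only [gen_apply]; grind
  by_cases ht2 : t = snd hn
  · by_cases hu1 : u = fst hn
    · refine Or.inl ⟨fst hn, key _ fun j => ?_⟩
      simp only [gen_apply]; grind
    · refine Or.inr ⟨fst hn, ?_⟩
      simp only [gen_apply]; grind
  · refine Or.inr ⟨t, ?_⟩
    simp only [gen_apply]; grind

theorem adj_mul_gen {hn : 3 ≤ n} (p : alternatingGroup (Fin n)) {t : Fin n} (ht : t ≠ trd hn) :
    (alternatingGroupNetwork n hn).Adj p (p * gen hn t) := by
  have h1 := fst_ne_snd hn
  have h2 := fst_ne_trd hn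
  have h3 := snd_ne_trd hn
  have key : ∀ j k, (gen hn t).1 k = j → p.1 j = (p * gen hn t).1 k := by
    rintro j k rfl; rfl
  by_cases ht1 : t = fst hn
  · refine Or.inr (Or.inl ⟨key _ _ ?_, key _ _ ?_, key _ _ ?_, fun j h1 h2 h3 => key _ _ ?_⟩) <;>
      rw [gen_apply] <;> simp only [fst, snd, trd] at * <;> grind
  by_cases ht2 : t = snd hn
  · refine Or.inl ⟨key _ _ ?_, key _ _ ?_, key _ _ ?_, fun j h1 h2 h3 => key _ _ ?_⟩ <;>
      rw [gen_apply] <;> simp only [fst, snd, trd] at * <;> grind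
  · refine Or.inr (Or.inr ⟨t, ht1, ht2, ht, key _ _ ?_, key _ _ ?_, key _ _ ?_, key _ _ ?_,
      fun j h1 h2 h3 h4 => key _ _ ?_⟩) <;>
      rw [gen_apply] <;> simp only [fst, snd, trd] at * <;> grind

theorem linked_mul_gen {hn : 3 ≤ n} {F : Finset (alternatingGroup (Fin n))}
    {p : alternatingGroup (Fin n)} {t : Fin n} (hp : p ∉ F) (hq : p * gen hn t ∉ F) :
    Linked (alternatingGroupNetwork n hn) F p (p * gen hn t) := by
  by_cases ht : t = trd hn
  · subst ht
    rw [gen_trd, mul_one]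
    exact Linked.refl hp
  · exact Linked.of_adj hp hq (adj_mul_gen p ht)

/-! ### Parity and prescribed symbols -/

/-- Even permutations that agree off the first two positions are equal. -/
theorem eq_of_eqOn {hn : 3 ≤ n} {p q : alternatingGroup (Fin n)}
    (h : ∀ j, j ≠ fst hn → j ≠ snd hn → p.1 j = q.1 j) : p = q := by
  have h1 := fst_ne_snd hn
  have hval : ∀ j, j = fst hn ∨ j = snd hn → q.1 j = p.1 (fst hn) ∨ q.1 j = p.1 (snd hn) := by
    intro j hj
    obtain ⟨k, hk⟩ := p.1.surjective (q.1 j)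
    by_contra hc
    have hk' := h k (by grind) (by grind)
    have := q.1.injective (hk'.symm.trans hk)
    grind
  by_cases hf : q.1 (fst hn) = p.1 (fst hn)
  · refine Subtype.ext (Perm.ext fun j => ?_)
    by_cases hj1 : j = fst hn
    · rw [hj1, hf]
    by_cases hj2 : j = snd hn
    · rcases hval _ (Or.inr rfl) with h' | h'
      · exact absurd (q.1.injective (h'.trans hf.symm)) h1.symm
      · rw [hj2, h']
    · exact h j hj1 hj2
  · have hf' := (hval _ (Or.inl rfl)).resolve_left hf
    have hs' : q.1 (snd hn) = p.1 (fst hn) := (hval _ (Or.inr rfl)).resolve_right fun h' =>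
      h1 (q.1.injective (hf'.trans h'.symm))
    -- The only other possibility is a transposition, which parity forbids.
    have hq : q.1 = p.1 * swap (fst hn) (snd hn) := by
      refine Perm.ext fun j => ?_
      simp only [Perm.coe_mul, Function.comp, swap_apply_def]
      split_ifs with hj1 hj2
      · rw [hj1, hf']
      · rw [hj2, hs']
      · exact (h j hj1 hj2).symm
    have hsq := Perm.mem_alternatingGroup.1 q.2
    rw [hq, Perm.sign_mul, Perm.mem_alternatingGroup.1 p.2, Perm.sign_swap h1] at hsq
    exact absurd hsq (by decide)

/-- Prescribing the symbols in the third position and in a further position, an even permutation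
can be found that differs from a given one only on a given set of positions. -/
theorem exists_apply_eq {hn : 3 ≤ n} (p : alternatingGroup (Fin n)) {T : Finset (Fin n)}
    (hT : lead hn ⊆ T) {s : Fin n} (hs : s ∉ lead hn) (hsT : s ∈ T) {u v : Fin n} (huv : u ≠ v)
    (hu : ∃ j ∈ T, p.1 j = u) (hv : ∃ j ∈ T, p.1 j = v) :
    ∃ q : alternatingGroup (Fin n), q.1 s = u ∧ q.1 (trd hn) = v ∧ ∀ j ∉ T, q.1 j = p.1 j := by
  have h1 := fst_ne_snd hn
  have h2 := fst_ne_trd hn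
  have h3 := snd_ne_trd hn
  have hT1 : fst hn ∈ T := hT (by simp [lead])
  have hT2 : snd hn ∈ T := hT (by simp [lead])
  have hT3 : trd hn ∈ T := hT (by simp [lead])
  rw [mem_lead] at hs
  obtain ⟨j, hj, rfl⟩ := hu
  obtain ⟨k, hk, rfl⟩ := hv
  have hjk : j ≠ k := fun h => huv (by rw [h])
  -- The inner swap targets `swap s j k` so that the outer one carries it back to `k`; it fixes `s`
  -- because `j ≠ k`.
  set σ : Perm (Fin n) := swap s j * swap (trd hn) (swap s j k) with hσ
  have hσs : σ s = j := by
    simp only [hσ, Perm.coe_mul, Function.comp, swap_apply_def]; grind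
  have hσ3 : σ (trd hn) = k := by simp [hσ]
  have hσT : ∀ i ∉ T, σ i = i := by
    intro i hi
    simp only [hσ, Perm.coe_mul, Function.comp, swap_apply_def]; grind
  rcases Int.units_eq_one_or (Perm.sign σ) with h | h
  · refine ⟨p * ⟨σ, Perm.mem_alternatingGroup.2 h⟩, ?_, ?_, fun i hi => ?_⟩
    · exact congrArg p.1 hσs
    · exact congrArg p.1 hσ3
    · exact congrArg p.1 (hσT i hi)
  -- The first two positions are unconstrained, so swapping them repairs the parity.
  · have hsg : Perm.sign (σ * swap (fst hn) (snd hn)) = 1 := by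
      rw [Perm.sign_mul, h, Perm.sign_swap h1]; rfl
    have hfix : ∀ i, i ≠ fst hn → i ≠ snd hn → (σ * swap (fst hn) (snd hn)) i = σ i :=
      fun i hi hi' => congrArg σ (swap_apply_of_ne_of_ne hi hi')
    refine ⟨p * ⟨_, Perm.mem_alternatingGroup.2 hsg⟩, ?_, ?_, fun i hi => ?_⟩
    · exact congrArg p.1 ((hfix s (by grind) (by grind)).trans hσs)
    · exact congrArg p.1 ((hfix _ h2.symm h3.symm).trans hσ3)
    · exact congrArg p.1 ((hfix i (by grind) (by grind)).trans (hσT i hi))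

/-! ### Subnetworks obtained by freezing positions -/

/-- `p` and `q` carry the same symbols in all positions outside `T`. -/
def AgreeOff (T : Finset (Fin n)) (p q : alternatingGroup (Fin n)) : Prop :=
  ∀ j ∉ T, p.1 j = q.1 j

instance (T : Finset (Fin n)) (q : alternatingGroup (Fin n)) :
    DecidablePred fun p => AgreeOff T p q := fun _ => by unfold AgreeOff; infer_instance

theorem AgreeOff.exists_mem {T : Finset (Fin n)} {p q : alternatingGroup (Fin n)}
    (h : AgreeOff T p q) {j : Fin n} (hj : j ∈ T) : ∃ k ∈ T, q.1 k = p.1 j := by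
  obtain ⟨k, hk⟩ := q.1.surjective (p.1 j)
  refine ⟨k, ?_, hk⟩
  by_contra hkT
  have := p.1.injective ((h k hkT).trans hk)
  exact hkT (this ▸ hj)

theorem agreeOff_insert_iff {T : Finset (Fin n)} {s : Fin n} (hs : s ∉ T)
    {p q r : alternatingGroup (Fin n)} (h : AgreeOff (insert s T) p r) :
    AgreeOff T q p ↔ AgreeOff (insert s T) q r ∧ q.1 s = p.1 s := by
  constructor
  · intro h'
    exact ⟨fun j hj => (h' j fun hjT => hj (Finset.mem_insert_of_mem hjT)).trans (h j hj), h' s hs⟩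
  · rintro ⟨h', hps⟩ j hj
    by_cases hjs : j = s
    · rw [hjs, hps]
    · have : j ∉ insert s T := by simp [hjs, hj]
      rw [h' j this, h j this]

theorem mul_gen_apply {hn : 3 ≤ n} (p : alternatingGroup (Fin n)) {s : Fin n}
    (hs : s ∉ lead hn) :
    (p * gen hn s).1 s = p.1 (trd hn) ∧ (p * gen hn s).1 (trd hn) = p.1 s :=
  ⟨congrArg p.1 (gen_apply_self hs), congrArg p.1 (gen_apply_trd hn s)⟩

theorem agreeOff_mul_gen {hn : 3 ≤ n} {T : Finset (Fin n)} (hT : lead hn ⊆ T)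
    {s : Fin n} (hs : s ∈ T) {p q : alternatingGroup (Fin n)} (h : AgreeOff T p q) :
    AgreeOff T (p * gen hn s) q := fun j hj =>
  (congrArg p.1 (gen_apply_of_ne (fun hl => hj (hT hl)) fun h => hj (h ▸ hs))).trans (h j hj)

/-- The smallest subnetwork is a triangle: by parity, the symbol in third position determines the
vertex. This is the base case of the connectivity induction. -/
theorem exists_eq_mul_gen_of_agreeOff_lead {hn : 3 ≤ n} {p q : alternatingGroup (Fin n)}
    (h : AgreeOff (lead hn) q p) : ∃ t, q = p * gen hn t := by
  have h3 : trd hn ∈ lead hn := by simp [lead]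
  obtain ⟨t, ht, htq⟩ := h.exists_mem h3
  refine ⟨t, eq_of_eqOn (hn := hn) fun j hj1 hj2 => ?_⟩
  by_cases hj3 : j = trd hn
  · rw [hj3, ← htq]
    exact congrArg p.1 (gen_apply_trd hn t).symm
  · have hj : j ∉ lead hn := by simp [mem_lead, hj1, hj2, hj3]
    rw [h j hj]
    exact congrArg p.1 (gen_apply_of_ne hj fun hjt => hj (hjt ▸ ht)).symm

/-! ### Connectivity of the subnetworks -/

/-- An unordered pair `{u, k}` or `{k, v}`, with `{u, v}` assigned to `k = v`, determines `k`. It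
makes the deleted vertices blocking different routes distinct. -/
theorem eq_of_pair {α : Type*} {a b u v k l : α} (hku : k ≠ u) (hlu : l ≠ u)
    (hk : (a = k ∨ b = k) ∧ (a = u ∨ b = u ∨ k ≠ v ∧ (a = v ∨ b = v)))
    (hl : (a = l ∨ b = l) ∧ (a = u ∨ b = u ∨ l ≠ v ∧ (a = v ∨ b = v))) : k = l := by
  grind

/-- Connectivity of the subnetworks: if `S` is a set of `m - 3` positions other than the leading
three, a copy of the network of dimension `m` obtained by letting the symbols in `S` and in the
leading positions vary stays connected after the deletion of any `m - 2` vertices. -/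
theorem linked_of_card_filter_le {hn : 3 ≤ n} (F : Finset (alternatingGroup (Fin n)))
    (S : Finset (Fin n)) (hS : Disjoint S (lead hn)) (o : alternatingGroup (Fin n))
    (hF : (F.filter fun q => AgreeOff (S ∪ lead hn) q o).card ≤ S.card + 1)
    {p q : alternatingGroup (Fin n)} (hp : p ∉ F) (hq : q ∉ F)
    (hpo : AgreeOff (S ∪ lead hn) p o) (hqo : AgreeOff (S ∪ lead hn) q o) :
    Linked (alternatingGroupNetwork n hn) F p q := by
  induction S using Finset.induction_on generalizing o p q with
  | empty =>
    rw [Finset.empty_union] at hpo hqo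
    obtain ⟨t, rfl⟩ := exists_eq_mul_gen_of_agreeOff_lead (p := p) (q := q)
      fun j hj => (hqo j hj).trans (hpo j hj).symm
    exact linked_mul_gen hp hq
  | insert s S hsS ih =>
    have hs : s ∉ lead hn := Finset.disjoint_left.1 hS (Finset.mem_insert_self s S)
    have hS' : Disjoint S (lead hn) :=
      Finset.disjoint_of_subset_left (Finset.subset_insert s S) hS
    rw [Finset.insert_union] at hF hpo hqo
    rw [Finset.card_insert_of_notMem hsS] at hF
    have hsT : s ∉ S ∪ lead hn := by simp [hsS, hs]
    set T := insert s (S ∪ lead hn) with hT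
    have hlT : lead hn ⊆ T := Finset.subset_union_right.trans (Finset.subset_insert s _)
    have hs_mem : s ∈ T := Finset.mem_insert_self s _
    have h3_mem : trd hn ∈ T := hlT (by simp [lead])
    set D := F.filter fun q => AgreeOff T q o with hD
    set vals := T.image o.1 with hvals
    have hcard : vals.card = S.card + 4 := by
      rw [hvals, Finset.card_image_of_injective _ o.1.injective, hT,
        Finset.card_insert_of_notMem hsT, Finset.card_union_of_disjoint hS', card_lead]
    have hmem : ∀ p, AgreeOff T p o → ∀ j ∈ T, p.1 j ∈ vals := by
      intro p hp j hj
      obtain ⟨k, hk, hkj⟩ := hp.exists_mem hj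
      exact Finset.mem_image.2 ⟨k, hk, hkj⟩
    have hsub : ∀ p q, AgreeOff T p o → AgreeOff T q o → q.1 s = p.1 s → p ∉ F → q ∉ F →
        (D.filter fun q => q.1 s = p.1 s).card ≤ S.card + 1 →
        Linked (alternatingGroupNetwork n hn) F p q := by
      intro p q hp hq hqp hpF hqF hc
      refine ih hS' p (le_of_eq_of_le (congrArg Finset.card ?_) hc) hpF hqF (fun _ _ => rfl)
        ((agreeOff_insert_iff hsT hp).2 ⟨hq, hqp⟩)
      rw [hD, Finset.filter_filter]
      exact Finset.filter_congr fun q _ => agreeOff_insert_iff hsT hp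
    have hedge : ∀ u ∈ vals, ∀ v ∈ vals, u ≠ v →
        (∃ z ∈ D, z.1 s = u ∧ z.1 (trd hn) = v ∨ z.1 s = v ∧ z.1 (trd hn) = u) ∨
        ∃ r r', AgreeOff T r o ∧ AgreeOff T r' o ∧ r.1 s = u ∧ r'.1 s = v ∧ r ∉ F ∧ r' ∉ F ∧
          Linked (alternatingGroupNetwork n hn) F r r' := by
      intro u hu v hv huv
      obtain ⟨r, hru, hrv, hr⟩ := exists_apply_eq o hlT hs hs_mem huv (Finset.mem_image.1 hu)
        (Finset.mem_image.1 hv)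
      obtain ⟨h1, h2⟩ := mul_gen_apply (hn := hn) r hs
      have hr' := agreeOff_mul_gen hlT hs_mem hr
      by_cases hrF : r ∈ F
      · exact Or.inl ⟨r, Finset.mem_filter.2 ⟨hrF, hr⟩, Or.inl ⟨hru, hrv⟩⟩
      by_cases hrF' : r * gen hn s ∈ F
      · exact Or.inl ⟨_, Finset.mem_filter.2 ⟨hrF', hr'⟩, Or.inr ⟨h1.trans hrv, h2.trans hru⟩⟩
      · exact Or.inr ⟨r, _, hr, hr', hru, h1.trans hrv, hrF, hrF', linked_mul_gen hrF hrF'⟩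
    -- Since `D` has at most `S.card + 2` elements, a class too damaged for the induction hypothesis
    -- contains all of them.
    have hbad : ∀ v, ¬ (D.filter fun q => q.1 s = v).card ≤ S.card + 1 →
        ∀ z ∈ D, z.1 s = v := by
      intro v hv
      have := Finset.card_le_card (Finset.filter_subset (fun q => q.1 s = v) D)
      exact Finset.filter_eq_self.1 (Finset.eq_of_subset_of_card_le (Finset.filter_subset _ _)
        (by omega))
    have hgood : ∀ p q, AgreeOff T p o → AgreeOff T q o → p ∉ F → q ∉ F →
        (D.filter fun r => r.1 s = p.1 s).card ≤ S.card + 1 →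
        (D.filter fun r => r.1 s = q.1 s).card ≤ S.card + 1 →
        Linked (alternatingGroupNetwork n hn) F p q := by
      intro p q hp hq hpF hqF hcp hcq
      by_cases hpq : q.1 s = p.1 s
      · exact hsub p q hp hq hpq hpF hqF hcp
      by_contra hcon
      have hpv := hmem p hp s hs_mem
      have hqv := hmem q hq s hs_mem
      have hstep : ∀ p q, AgreeOff T p o → AgreeOff T q o → p ∉ F → q ∉ F →
          (D.filter fun r => r.1 s = p.1 s).card ≤ S.card + 1 →
          (D.filter fun r => r.1 s = q.1 s).card ≤ S.card + 1 → ∀ r r',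
          AgreeOff T r o ∧ AgreeOff T r' o ∧ r.1 s = p.1 s ∧ r'.1 s = q.1 s ∧ r ∉ F ∧ r' ∉ F ∧
          Linked (alternatingGroupNetwork n hn) F r r' →
          Linked (alternatingGroupNetwork n hn) F p q := by
        rintro p q hp hq hpF hqF hcp hcq r r' ⟨hr, hr', hrp, hrq, hrF, hrF', hl⟩
        exact ((hsub p r hp hr hrp hpF hrF hcp).trans hl).trans
          (hsub q r' hq hr' hrq hqF hrF' hcq).symm
      obtain ⟨z₀, hz₀, hz₀'⟩ := (hedge _ hpv _ hqv (Ne.symm hpq)).resolve_right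
        fun ⟨r, r', h⟩ => hcon (hstep p q hp hq hpF hqF hcp hcq r r' h)
      -- The detour through class `k` must be blocked as well. Class `k` is itself connected:
      -- otherwise it would contain `z₀`, which lies in the class of `p` or of `q`.
      have hmid : ∀ k ∈ vals, k ≠ p.1 s → k ≠ q.1 s → ∃ z ∈ D,
          (z.1 s = p.1 s ∧ z.1 (trd hn) = k ∨ z.1 s = k ∧ z.1 (trd hn) = p.1 s) ∨
          (z.1 s = k ∧ z.1 (trd hn) = q.1 s ∨ z.1 s = q.1 s ∧ z.1 (trd hn) = k) := by
        intro k hk hkp hkq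
        have hck : (D.filter fun r => r.1 s = k).card ≤ S.card + 1 := by
          by_contra hck
          have := hbad k hck z₀ hz₀
          rcases hz₀' with h | h
          · exact hkp (this.symm.trans h.1)
          · exact hkq (this.symm.trans h.1)
        by_contra hno
        obtain ⟨r, m, h1⟩ := (hedge _ hpv k hk (Ne.symm hkp)).resolve_left
          fun ⟨z, hz, hz'⟩ => hno ⟨z, hz, Or.inl hz'⟩
        obtain ⟨r₁, r₂, h2⟩ := (hedge k hk _ hqv hkq).resolve_left
          fun ⟨z, hz, hz'⟩ => hno ⟨z, hz, Or.inr hz'⟩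
        obtain ⟨hr, hm, hrp, rfl, hrF, hmF, hl⟩ := h1
        exact hcon ((hstep p m hp hm hpF hmF hcp hck r m ⟨hr, hm, hrp, rfl, hrF, hmF, hl⟩).trans
          (hstep m q hm hq hmF hqF hck hcq r₁ r₂ h2))
      have hall : ∀ k, ∃ z, k ∈ vals.erase (p.1 s) → z ∈ D ∧
          (z.1 s = k ∨ z.1 (trd hn) = k) ∧
          (z.1 s = p.1 s ∨ z.1 (trd hn) = p.1 s ∨
            k ≠ q.1 s ∧ (z.1 s = q.1 s ∨ z.1 (trd hn) = q.1 s)) := by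
        intro k
        by_cases hk : k ∈ vals.erase (p.1 s)
        · rw [Finset.mem_erase] at hk
          by_cases hkq : k = q.1 s
          · exact ⟨z₀, fun _ => ⟨hz₀, hkq ▸ by clear * - hz₀'; tauto, by clear * - hz₀'; tauto⟩⟩
          · obtain ⟨z, hz, hz'⟩ := hmid k hk.2 hk.1 hkq
            exact ⟨z, fun _ => ⟨hz, by clear * - hz'; tauto, by clear * - hz' hkq; tauto⟩⟩
        -- A dummy value, outside the set on which the choice matters.
        · exact ⟨p, fun h => absurd h hk⟩
      choose f hf using hall
      -- The direct route and the detours number `S.card + 3`, one more than the available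
      -- deletions.
      have hle := Finset.card_le_card_of_injOn (s := vals.erase (p.1 s)) (t := D) f
        (fun k hk => (hf k hk).1) (by
          intro k hk l hl hkl
          have h1 := (hf k hk).2
          have h2 := (hf l hl).2
          have h3 := (Finset.mem_erase.1 hk).1
          have h4 := (Finset.mem_erase.1 hl).1
          rw [← hkl] at h2
          exact eq_of_pair h3 h4 h1 h2)
      rw [Finset.card_erase_of_mem hpv] at hle
      omega
    have htogood : ∀ p, AgreeOff T p o → p ∉ F → ∃ p', AgreeOff T p' o ∧ p' ∉ F ∧
        (D.filter fun r => r.1 s = p'.1 s).card ≤ S.card + 1 ∧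
        Linked (alternatingGroupNetwork n hn) F p p' := by
      intro p hp hpF
      by_cases hc : (D.filter fun r => r.1 s = p.1 s).card ≤ S.card + 1
      · exact ⟨p, hp, hpF, hc, Linked.refl hpF⟩
      have hall := hbad _ hc
      have hne : (p * gen hn s).1 s ≠ p.1 s := by
        rw [(mul_gen_apply p hs).1]
        intro h
        exact hs (p.1.injective h ▸ (by simp [lead] : trd hn ∈ lead hn))
      have hp' := agreeOff_mul_gen hlT hs_mem hp
      -- All deletions lie in the class of `p`, so the matching edge leads into an intact class.
      have hpF' : p * gen hn s ∉ F := fun h => hne (hall _ (Finset.mem_filter.2 ⟨h, hp'⟩))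
      refine ⟨_, hp', hpF', ?_, linked_mul_gen hpF hpF'⟩
      rw [Finset.filter_eq_empty_iff.2 fun z hz h => hne (h.symm.trans (hall z hz))]
      simp
    obtain ⟨p', hp', hpF', hcp, hlp⟩ := htogood p hpo hp
    obtain ⟨q', hq', hqF', hcq, hlq⟩ := htogood q hqo hq
    exact (hlp.trans (hgood p' q' hp' hq' hpF' hqF' hcp hcq)).trans hlq.symm

/-- Freezing only `s` leaves `n - 4` free non-leading positions, whence the bound `(n - 4) + 1`. -/
theorem linked_of_apply_eq {hn : 3 ≤ n} {s : Fin n} (hs : s ∉ lead hn)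
    {F : Finset (alternatingGroup (Fin n))} {p q : alternatingGroup (Fin n)}
    (hF : (F.filter fun r => r.1 s = p.1 s).card ≤ n - 3) (hp : p ∉ F) (hq : q ∉ F)
    (hpq : q.1 s = p.1 s) : Linked (alternatingGroupNetwork n hn) F p q := by
  have hd : Disjoint ((insert s (lead hn))ᶜ) (lead hn) := by
    rw [Finset.disjoint_left]
    intro j hj hj'
    simp [hj'] at hj
  have hcard : ((insert s (lead hn))ᶜ).card = n - 4 := by
    rw [Finset.card_compl, Finset.card_insert_of_notMem hs, card_lead, Fintype.card_fin]
  have hn4 : 4 ≤ n := by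
    have := Finset.card_le_univ (insert s (lead hn))
    rwa [Finset.card_insert_of_notMem hs, card_lead, Fintype.card_fin] at this
  have hmem : ∀ j, j ∉ (insert s (lead hn))ᶜ ∪ lead hn ↔ j = s := by
    intro j
    simp only [Finset.mem_union, Finset.mem_compl, Finset.mem_insert]
    constructor
    · tauto
    · rintro rfl; tauto
  have hag : ∀ r, AgreeOff ((insert s (lead hn))ᶜ ∪ lead hn) r p ↔ r.1 s = p.1 s := by
    intro r
    simp only [AgreeOff, hmem, forall_eq]
  refine linked_of_card_filter_le F _ hd p ?_ hp hq ((hag p).2 rfl) ((hag q).2 hpq)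
  rw [Finset.filter_congr fun r _ => hag r, hcard]
  omega

/-! ### Counting vertices and matching edges -/

theorem six_mul_le_factorial {m : ℕ} (hm : 4 ≤ m) : 6 * m ≤ m.factorial := by
  induction m, hm using Nat.le_induction with
  | base => decide
  | succ m hm ih =>
    rw [Nat.factorial_succ]
    nlinarith

theorem card_alternatingGroup_ge {β : Type*} [Fintype β] [DecidableEq β] (hβ : 4 ≤ Fintype.card β) :
    3 * Fintype.card β ≤ Fintype.card (alternatingGroup β) := by
  have : Nontrivial β := Fintype.one_lt_card_iff_nontrivial.1 (by omega)
  have h1 : 2 * Fintype.card (alternatingGroup β) = (Fintype.card β).factorial := by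
    rw [two_mul_card_alternatingGroup, Fintype.card_perm]
  have h2 := six_mul_le_factorial hβ
  omega

/-- There are many even permutations with two prescribed symbols. -/
theorem card_filter_apply_eq {hn : 3 ≤ n} (hn6 : 6 ≤ n) {s : Fin n} (hs : s ∉ lead hn)
    {u v : Fin n} (huv : u ≠ v) :
    3 * n - 6 ≤ (Finset.univ.filter fun q : alternatingGroup (Fin n) =>
      q.1 s = u ∧ q.1 (trd hn) = v).card := by
  have hs3 : s ≠ trd hn := fun h => hs (by simp [lead, h])
  obtain ⟨p, hps, hp3, -⟩ := exists_apply_eq (1 : alternatingGroup (Fin n))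
    (Finset.subset_univ (lead hn)) hs (Finset.mem_univ s) huv
    ⟨u, Finset.mem_univ _, rfl⟩ ⟨v, Finset.mem_univ _, rfl⟩
  have hβ : Fintype.card {j : Fin n // j ≠ s ∧ j ≠ trd hn} = n - 2 := by
    rw [Fintype.card_subtype]
    have : (Finset.univ.filter fun j : Fin n => j ≠ s ∧ j ≠ trd hn) = {s, trd hn}ᶜ := by
      ext j; simp
    rw [this, Finset.card_compl, Finset.card_pair hs3, Fintype.card_fin]
  have hle := card_alternatingGroup_ge (β := {j : Fin n // j ≠ s ∧ j ≠ trd hn}) (by omega)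
  rw [hβ, ← Finset.card_univ] at hle
  -- Even permutations of the other `n - 2` positions act without changing the two prescribed
  -- symbols.
  let f : alternatingGroup {j : Fin n // j ≠ s ∧ j ≠ trd hn} → alternatingGroup (Fin n) :=
    fun τ => p * ⟨Perm.ofSubtype τ.1, Perm.mem_alternatingGroup.2
      ((Perm.sign_ofSubtype _).trans (Perm.mem_alternatingGroup.1 τ.2))⟩
  have hfix : ∀ τ, (f τ).1 s = p.1 s ∧ (f τ).1 (trd hn) = p.1 (trd hn) := fun τ =>
    ⟨congrArg p.1 (Perm.ofSubtype_apply_of_not_mem _ (by simp)),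
      congrArg p.1 (Perm.ofSubtype_apply_of_not_mem _ (by simp))⟩
  have hcard := Finset.card_le_card_of_injOn (s := Finset.univ)
    (t := Finset.univ.filter fun q : alternatingGroup (Fin n) =>
      q.1 s = u ∧ q.1 (trd hn) = v) f
    (fun τ _ => Finset.mem_filter.2 ⟨Finset.mem_univ _, (hfix τ).1.trans hps,
      (hfix τ).2.trans hp3⟩)
    (fun τ _ τ' _ h => Subtype.ext (Perm.ofSubtype_injective
      (congrArg Subtype.val (mul_left_cancel h))))
  omega

/-- A set of vertices, no two of which are matched with each other by right multiplication by
`gen hn s`, and each of which is in `F` or matched with an element of `F`, is no larger than `F`. -/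
theorem card_le_of_matching {hn : 3 ≤ n} {s : Fin n} (hs : s ∉ lead hn)
    {F U : Finset (alternatingGroup (Fin n))} (hUF : ∀ z ∈ U, z ∈ F ∨ z * gen hn s ∈ F)
    (hU : ∀ z ∈ U, z * gen hn s ∉ U) : U.card ≤ F.card := by
  have hinv : ∀ z, z * gen hn s * gen hn s = z := fun z => by
    rw [mul_assoc, gen_mul_self hs, mul_one]
  refine Finset.card_le_card_of_injOn (fun z => if z ∈ F then z else z * gen hn s) ?_ ?_
  · intro z hz
    change (if z ∈ F then z else z * gen hn s) ∈ F
    split_ifs with h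
    · exact h
    · exact (hUF z hz).resolve_left h
  · intro z hz w hw hzw
    change (if z ∈ F then z else z * gen hn s) = (if w ∈ F then w else w * gen hn s) at hzw
    split_ifs at hzw with h1 h2 h2
    · exact hzw
    · exact absurd hz (hzw ▸ hU w hw)
    · exact absurd hw (hzw ▸ hU z hz)
    · exact mul_right_cancel hzw

/-! ### Closed neighbourhoods -/

/-- The closed neighbourhood of `z` in the subnetwork of permutations with the symbol of `z` in
position `s`. -/
def ball (hn : 3 ≤ n) (s : Fin n) (z : alternatingGroup (Fin n)) :
    Finset (alternatingGroup (Fin n)) :=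
  (Finset.univ.erase s).image fun t => z * gen hn t

theorem mul_gen_apply_trd {hn : 3 ≤ n} (z : alternatingGroup (Fin n)) (t : Fin n) :
    (z * gen hn t).1 (trd hn) = z.1 t := congrArg z.1 (gen_apply_trd hn t)

theorem mem_ball {hn : 3 ≤ n} {s : Fin n} {z w : alternatingGroup (Fin n)} :
    w ∈ ball hn s z ↔ ∃ t, t ≠ s ∧ z * gen hn t = w := by simp [ball]

theorem card_ball {hn : 3 ≤ n} (s : Fin n) (z : alternatingGroup (Fin n)) :
    (ball hn s z).card = n - 1 := by
  rw [ball, Finset.card_image_of_injective, Finset.card_erase_of_mem (Finset.mem_univ s),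
    Finset.card_univ, Fintype.card_fin]
  intro t t' h
  have := congrArg (fun q : alternatingGroup (Fin n) => q.1 (trd hn)) h
  simp only [mul_gen_apply_trd] at this
  exact z.1.injective this

theorem eq_of_mem_ball {hn : 3 ≤ n} {s : Fin n} {z w w' : alternatingGroup (Fin n)}
    (hw : w ∈ ball hn s z) (hw' : w' ∈ ball hn s z) (h : w.1 (trd hn) = w'.1 (trd hn)) :
    w = w' := by
  obtain ⟨t, -, rfl⟩ := mem_ball.1 hw
  obtain ⟨t', -, rfl⟩ := mem_ball.1 hw'
  rw [mul_gen_apply_trd, mul_gen_apply_trd] at h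
  rw [z.1.injective h]

theorem apply_of_mem_ball {hn : 3 ≤ n} {s : Fin n} (hs : s ∉ lead hn)
    {z w : alternatingGroup (Fin n)} (hw : w ∈ ball hn s z) : w.1 s = z.1 s := by
  obtain ⟨t, ht, rfl⟩ := mem_ball.1 hw
  exact congrArg z.1 (gen_apply_of_ne hs (Ne.symm ht))

theorem card_filter_ball_le {hn : 3 ≤ n} (s : Fin n) (z : alternatingGroup (Fin n)) (v : Fin n) :
    ((ball hn s z).filter fun w => w.1 (trd hn) = v).card ≤ 1 :=
  Finset.card_le_one.2 fun w hw w' hw' => by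
    rw [Finset.mem_filter] at hw hw'
    exact eq_of_mem_ball hw.1 hw'.1 (hw.2.trans hw'.2.symm)

theorem linked_of_mem_ball {hn : 3 ≤ n} {s : Fin n} {F : Finset (alternatingGroup (Fin n))}
    {z w : alternatingGroup (Fin n)} (hw : w ∈ ball hn s z) (hz : z ∉ F) (hwF : w ∉ F) :
    Linked (alternatingGroupNetwork n hn) F z w := by
  obtain ⟨t, ht, rfl⟩ := mem_ball.1 hw
  exact linked_mul_gen hz hwF

/-- If `a * gen hn t = b * gen hn u`, then either `a` and `b` differ by a generator and are linked,
or evaluation at the `j` of `gen_quotient` gives `a (trd) = b t`, which determines `t`. -/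
theorem card_ball_inter_le {hn : 3 ≤ n} {s : Fin n} {F : Finset (alternatingGroup (Fin n))}
    {a b : alternatingGroup (Fin n)} (ha : a ∉ F) (hb : b ∉ F)
    (hab : ¬ Linked (alternatingGroupNetwork n hn) F a b) :
    (ball hn s a ∩ ball hn s b).card ≤ 1 := by
  have key : ∀ w ∈ ball hn s a ∩ ball hn s b, w = a * gen hn (b.1.symm (a.1 (trd hn))) := by
    intro w hw
    rw [Finset.mem_inter] at hw
    obtain ⟨t, -, htw⟩ := mem_ball.1 hw.1
    obtain ⟨u, -, huw⟩ := mem_ball.1 hw.2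
    have htu : a * gen hn t = b * gen hn u := htw.trans huw.symm
    rcases gen_quotient hn t u with ⟨v, hv⟩ | ⟨j, hj, hj'⟩
    · rw [hv, ← mul_assoc] at htu
      have := mul_right_cancel htu
      subst this
      exact absurd (linked_mul_gen ha hb) hab
    · have h1 : a.1 ((gen hn t).1 j) = b.1 ((gen hn u).1 j) :=
        congrArg (fun q : alternatingGroup (Fin n) => q.1 j) htu
      rw [hj, hj'] at h1
      rw [h1, Equiv.symm_apply_apply, htw]
  exact Finset.card_le_one.2 fun w hw w' hw' => (key w hw).trans (key w' hw').symm

theorem card_union_ge {α : Type*} [DecidableEq α] {A B C : Finset α} (hAB : (A ∩ B).card ≤ 1)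
    (hAC : (A ∩ C).card ≤ 1) (hBC : (B ∩ C).card ≤ 1) :
    A.card + B.card + C.card ≤ (A ∪ B ∪ C).card + 3 := by
  have h1 := Finset.card_union_add_card_inter A B
  have h2 := Finset.card_union_add_card_inter (A ∪ B) C
  rw [Finset.union_inter_distrib_right] at h2
  have h3 := Finset.card_union_le (A ∩ C) (B ∩ C)
  omega

/-! ### Components away from the well-connected subnetworks -/

/-- At most `n - 3` of the vertices with symbol `v` in position `s` belong to `F`. -/
def Sparse (s : Fin n) (F : Finset (alternatingGroup (Fin n))) (v : Fin n) : Prop :=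
  (F.filter fun r => r.1 s = v).card ≤ n - 3

/-- `z` is not deleted, and its component meets no sparse subnetwork. -/
def Stuck (hn : 3 ≤ n) (s : Fin n) (F : Finset (alternatingGroup (Fin n)))
    (z : alternatingGroup (Fin n)) : Prop :=
  z ∉ F ∧ ∀ q, Sparse s F (q.1 s) → ¬ Linked (alternatingGroupNetwork n hn) F z q

theorem Stuck.of_linked {hn : 3 ≤ n} {s : Fin n} {F : Finset (alternatingGroup (Fin n))}
    {z w : alternatingGroup (Fin n)} (h : Stuck hn s F z)
    (hl : Linked (alternatingGroupNetwork n hn) F z w) : Stuck hn s F w :=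
  ⟨hl.2.1, fun q hq hwq => h.2 q hq (hl.trans hwq)⟩

theorem Stuck.not_sparse {hn : 3 ≤ n} {s : Fin n} {F : Finset (alternatingGroup (Fin n))}
    {z : alternatingGroup (Fin n)} (h : Stuck hn s F z) : ¬ Sparse s F (z.1 s) :=
  fun hz => h.2 z hz (Linked.refl h.1)

/-- Otherwise the path from `z` through `w` and its matching edge would reach a sparse class. -/
theorem Stuck.mem_or_mem {hn : 3 ≤ n} {s : Fin n} (hs : s ∉ lead hn)
    {F : Finset (alternatingGroup (Fin n))} {z w : alternatingGroup (Fin n)}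
    (h : Stuck hn s F z) (hw : w ∈ ball hn s z) (hsp : Sparse s F (w.1 (trd hn))) :
    w ∈ F ∨ w * gen hn s ∈ F := by
  by_contra! hno
  have hl := (linked_of_mem_ball hw h.1 hno.1).trans (linked_mul_gen hno.1 hno.2)
  exact h.2 _ (by rwa [(mul_gen_apply w hs).1]) hl

/-- Two sparse classes are each connected, and some matching edge between them survives because
there are more such edges than deletions. -/
theorem linked_of_sparse {hn : 3 ≤ n} (hn6 : 6 ≤ n) {s : Fin n} (hs : s ∉ lead hn)
    {F : Finset (alternatingGroup (Fin n))} (hF : F.card ≤ 3 * n - 7)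
    {p q : alternatingGroup (Fin n)} (hp : p ∉ F) (hq : q ∉ F) (hps : Sparse s F (p.1 s))
    (hqs : Sparse s F (q.1 s)) : Linked (alternatingGroupNetwork n hn) F p q := by
  by_cases hpq : q.1 s = p.1 s
  · exact linked_of_apply_eq hs hps hp hq hpq
  have hcard := card_filter_apply_eq (hn := hn) hn6 hs (Ne.symm hpq)
  by_cases hex : ∃ r : alternatingGroup (Fin n), r.1 s = p.1 s ∧ r.1 (trd hn) = q.1 s ∧
      r ∉ F ∧ r * gen hn s ∉ F
  · obtain ⟨r, hr, hr3, hrF, hrF'⟩ := hex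
    refine ((linked_of_apply_eq hs hps hp hrF hr).trans (linked_mul_gen hrF hrF')).trans
      (linked_of_apply_eq hs hqs hq hrF' ?_).symm
    rw [(mul_gen_apply r hs).1, hr3]
  · have := card_le_of_matching (F := F) hs
      (U := Finset.univ.filter fun q' : alternatingGroup (Fin n) =>
        q'.1 s = p.1 s ∧ q'.1 (trd hn) = q.1 s)
      (fun z hz => by
        rw [Finset.mem_filter] at hz
        by_contra! h
        exact hex ⟨z, hz.2.1, hz.2.2, h⟩)
      (fun z hz hz' => by
        rw [Finset.mem_filter] at hz hz'
        rw [(mul_gen_apply z hs).1] at hz'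
        exact hpq (hz.2.2.symm.trans hz'.2.1))
    omega

/-- At most two subnetworks are not sparse. -/
theorem sparse_of_ne {s : Fin n} (hn3 : 3 ≤ n) {F : Finset (alternatingGroup (Fin n))}
    (hF : F.card ≤ 3 * n - 7) {u v w : Fin n} (hu : ¬ Sparse s F u) (hv : ¬ Sparse s F v)
    (huv : u ≠ v) (hwu : w ≠ u) (hwv : w ≠ v) : Sparse s F w := by
  by_contra hw
  unfold Sparse at hu hv hw
  have hsub : (F.filter fun r => r.1 s = u) ∪ (F.filter fun r => r.1 s = v) ∪
      (F.filter fun r => r.1 s = w) ⊆ F := by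
    intro r
    simp only [Finset.mem_union, Finset.mem_filter]
    tauto
  have h := Finset.card_le_card hsub
  rw [Finset.card_union_of_disjoint, Finset.card_union_of_disjoint] at h
  · omega
  · rw [Finset.disjoint_left]
    simp only [Finset.mem_filter]
    rintro r ⟨-, rfl⟩ ⟨-, h⟩
    exact huv h
  · rw [Finset.disjoint_left]
    simp only [Finset.mem_union, Finset.mem_filter]
    rintro r (⟨-, rfl⟩ | ⟨-, rfl⟩) ⟨-, h⟩
    · exact hwu h.symm
    · exact hwv h.symm

theorem apply_trd_ne {hn : 3 ≤ n} {s : Fin n} (hs : s ∉ lead hn) (z : alternatingGroup (Fin n)) :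
    z.1 (trd hn) ≠ z.1 s := fun h => hs (by simp [lead, ← z.1.injective h])

/-! ### Excluding three stuck components -/

/-- Three stuck components that meet the same subnetwork. -/
theorem card_ge_of_stuck_of_eq {hn : 3 ≤ n} (hn6 : 6 ≤ n) {s : Fin n} (hs : s ∉ lead hn)
    {F : Finset (alternatingGroup (Fin n))} {a b c : alternatingGroup (Fin n)}
    (ha : Stuck hn s F a) (hb : Stuck hn s F b) (hc : Stuck hn s F c)
    (hab : ¬ Linked (alternatingGroupNetwork n hn) F a b)
    (hac : ¬ Linked (alternatingGroupNetwork n hn) F a c)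
    (hbc : ¬ Linked (alternatingGroupNetwork n hn) F b c)
    (hb_eq : b.1 s = a.1 s) (hc_eq : c.1 s = a.1 s) : 3 * n - 6 ≤ F.card := by
  by_contra hlt
  have hF : F.card ≤ 3 * n - 7 := by omega
  have hU := card_union_ge (card_ball_inter_le (s := s) ha.1 hb.1 hab)
    (card_ball_inter_le (s := s) ha.1 hc.1 hac) (card_ball_inter_le (s := s) hb.1 hc.1 hbc)
  simp only [card_ball] at hU
  set U := ball hn s a ∪ ball hn s b ∪ ball hn s c with hUdef
  have hUs : ∀ z ∈ U, z.1 s = a.1 s := by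
    intro z hz
    rw [hUdef, Finset.mem_union, Finset.mem_union] at hz
    rcases hz with (hz | hz) | hz
    · exact apply_of_mem_ball hs hz
    · exact (apply_of_mem_ball hs hz).trans hb_eq
    · exact (apply_of_mem_ball hs hz).trans hc_eq
  have hUF : ∀ z ∈ U, Sparse s F (z.1 (trd hn)) → z ∈ F ∨ z * gen hn s ∈ F := by
    intro z hz hsp
    rw [hUdef, Finset.mem_union, Finset.mem_union] at hz
    rcases hz with (hz | hz) | hz
    · exact ha.mem_or_mem hs hz hsp
    · exact hb.mem_or_mem hs hz hsp
    · exact hc.mem_or_mem hs hz hsp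
  have hUout : ∀ z ∈ U, z * gen hn s ∉ U := by
    intro z hz hz'
    have := hUs _ hz'
    rw [(mul_gen_apply z hs).1, ← hUs z hz] at this
    exact apply_trd_ne hs z this
  by_cases hex : ∃ v, v ≠ a.1 s ∧ ¬ Sparse s F v
  -- Dropping at most three vertices matched into class `v` leaves `3n - 9`, which force deletions
  -- outside that class; with the `n - 2` inside it this makes `4n - 11 ≥ 3n - 6`.
  · obtain ⟨v, hva, hv⟩ := hex
    have hsp : ∀ z ∈ U, z.1 (trd hn) ≠ v → Sparse s F (z.1 (trd hn)) := fun z hz hzv =>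
      sparse_of_ne hn hF ha.not_sparse hv hva.symm (hUs z hz ▸ apply_trd_ne hs z) hzv
    have h1 := Finset.card_filter_add_card_filter_not (s := U) (fun z => z.1 (trd hn) = v)
    have h2 : (U.filter fun z => z.1 (trd hn) = v).card ≤ 3 := by
      rw [hUdef, Finset.filter_union, Finset.filter_union]
      have e1 := card_filter_ball_le (hn := hn) s a v
      have e2 := card_filter_ball_le (hn := hn) s b v
      have e3 := card_filter_ball_le (hn := hn) s c v
      exact (Finset.card_union_le _ _).trans
        ((Nat.add_le_add ((Finset.card_union_le _ _).trans (Nat.add_le_add e1 e2)) e3))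
    have h3 := card_le_of_matching (F := F.filter fun r => ¬ r.1 s = v)
      (U := U.filter fun z => ¬ z.1 (trd hn) = v) hs
      (fun z hz => by
        rw [Finset.mem_filter] at hz
        rcases hUF z hz.1 (hsp z hz.1 hz.2) with h | h
        · exact Or.inl (Finset.mem_filter.2 ⟨h, by rw [hUs z hz.1]; exact hva.symm⟩)
        · exact Or.inr (Finset.mem_filter.2 ⟨h, by rw [(mul_gen_apply z hs).1]; exact hz.2⟩))
      (fun z hz hz' => hUout z (Finset.mem_filter.1 hz).1 (Finset.mem_filter.1 hz').1)
    have h4 := Finset.card_filter_add_card_filter_not (s := F) (fun r => r.1 s = v)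
    unfold Sparse at hv
    omega
  · push Not at hex
    have := card_le_of_matching (F := F) hs
      (fun z hz => hUF z hz (hex _ (hUs z hz ▸ apply_trd_ne hs z))) hUout
    omega

/-- Three stuck components, of which one has a vertex in a different subnetwork. -/
theorem card_ge_of_stuck_of_ne {hn : 3 ≤ n} (hn6 : 6 ≤ n) {s : Fin n} (hs : s ∉ lead hn)
    {F : Finset (alternatingGroup (Fin n))} {a b c : alternatingGroup (Fin n)}
    (ha : Stuck hn s F a) (hb : Stuck hn s F b) (hc : Stuck hn s F c)
    (hab : ¬ Linked (alternatingGroupNetwork n hn) F a b)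
    (hac : ¬ Linked (alternatingGroupNetwork n hn) F a c)
    (hb_eq : b.1 s = a.1 s) (hc_ne : c.1 s ≠ a.1 s) : 3 * n - 6 ≤ F.card := by
  by_contra hlt
  have hF : F.card ≤ 3 * n - 7 := by omega
  have hsp : ∀ v, v ≠ a.1 s → v ≠ c.1 s → Sparse s F v := fun v hv hv' =>
    sparse_of_ne hn hF ha.not_sparse hc.not_sparse hc_ne.symm hv hv'
  -- The count falls one short: `A` has at least `(2n - 3) - 2` vertices and `C` at least `(n - 1) -
  -- 1`, in all `3n - 7`.
  have hU1 := Finset.card_union_add_card_inter (ball hn s a) (ball hn s b)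
  have hU1' := card_ball_inter_le (s := s) ha.1 hb.1 hab
  simp only [card_ball] at hU1
  have h1 := Finset.card_filter_add_card_filter_not (s := ball hn s a ∪ ball hn s b)
    (fun z => z.1 (trd hn) = c.1 s)
  have h2 : ((ball hn s a ∪ ball hn s b).filter fun z => z.1 (trd hn) = c.1 s).card ≤ 2 := by
    rw [Finset.filter_union]
    exact (Finset.card_union_le _ _).trans
      (Nat.add_le_add (card_filter_ball_le s a _) (card_filter_ball_le s b _))
  have h3 := Finset.card_filter_add_card_filter_not (s := ball hn s c)
    (fun z => z.1 (trd hn) = a.1 s)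
  have h4 := card_filter_ball_le (hn := hn) s c (a.1 s)
  rw [card_ball] at h3
  set A := (ball hn s a ∪ ball hn s b).filter fun z => ¬ z.1 (trd hn) = c.1 s with hA
  set C := (ball hn s c).filter fun z => ¬ z.1 (trd hn) = a.1 s with hC
  have hAs : ∀ z ∈ A, z.1 s = a.1 s := by
    intro z hz
    rw [hA, Finset.mem_filter, Finset.mem_union] at hz
    rcases hz.1 with hz | hz
    · exact apply_of_mem_ball hs hz
    · exact (apply_of_mem_ball hs hz).trans hb_eq
  have hCs : ∀ z ∈ C, z.1 s = c.1 s := fun z hz =>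
    apply_of_mem_ball hs (Finset.mem_filter.1 hz).1
  have hdisj : Disjoint A C := by
    rw [Finset.disjoint_left]
    intro z hz hz'
    exact hc_ne ((hCs z hz').symm.trans (hAs z hz))
  have hcard := Finset.card_union_of_disjoint hdisj
  have hs_or : ∀ z ∈ A ∪ C, z.1 s = a.1 s ∨ z.1 s = c.1 s := fun z hz =>
    (Finset.mem_union.1 hz).imp (hAs z) (hCs z)
  have htrd : ∀ z ∈ A ∪ C, z.1 (trd hn) ≠ a.1 s ∧ z.1 (trd hn) ≠ c.1 s := by
    intro z hz
    rcases Finset.mem_union.1 hz with hz | hz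
    · exact ⟨hAs z hz ▸ apply_trd_ne hs z, (Finset.mem_filter.1 hz).2⟩
    · exact ⟨(Finset.mem_filter.1 hz).2, hCs z hz ▸ apply_trd_ne hs z⟩
  have hUF : ∀ z ∈ A ∪ C, z ∈ F ∨ z * gen hn s ∈ F := by
    intro z hz
    have hz3 := hsp _ (htrd z hz).1 (htrd z hz).2
    rw [hA, hC, Finset.mem_union, Finset.mem_filter, Finset.mem_filter, Finset.mem_union] at hz
    rcases hz with ⟨hz | hz, -⟩ | ⟨hz, -⟩
    · exact ha.mem_or_mem hs hz hz3
    · exact hb.mem_or_mem hs hz hz3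
    · exact hc.mem_or_mem hs hz hz3
  -- One more vertex with the properties of those in `A ∪ C` gives a contradiction.
  have hextra : ∀ e, e ∉ A ∪ C → (e.1 s = a.1 s ∨ e.1 s = c.1 s) → e * gen hn s ∉ A ∪ C →
      (e ∈ F ∨ e * gen hn s ∈ F) → False := by
    intro e he hes he' heF
    have hle := card_le_of_matching (F := F) (U := insert e (A ∪ C)) hs
      (fun z hz => by
        rcases Finset.mem_insert.1 hz with rfl | hz
        · exact heF
        · exact hUF z hz)
      (fun z hz hz' => by
        have hne := (mul_gen_apply (hn := hn) z hs).1
        rcases Finset.mem_insert.1 hz with rfl | hz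
        · rcases Finset.mem_insert.1 hz' with h | h
          · rw [h] at hne
            exact apply_trd_ne hs z hne.symm
          · exact he' h
        · have h' : (z * gen hn s).1 s = a.1 s ∨ (z * gen hn s).1 s = c.1 s := by
            rcases Finset.mem_insert.1 hz' with h | h
            · rw [h]; exact hes
            · exact hs_or _ h
          rw [hne] at h'
          exact h'.elim (htrd z hz).1 (htrd z hz).2)
    rw [Finset.card_insert_of_notMem he] at hle
    omega
  -- The extra vertex comes from the edge between the two dense classes at `x`, the member of the
  -- closed neighbourhood of `a` matched into the class of `c`. If an end of it is deleted, `x`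
  -- itself serves.
  obtain ⟨t, ht⟩ := a.1.surjective (c.1 s)
  have hts : t ≠ s := fun h => hc_ne (by rw [← ht, h])
  have hxb : a * gen hn t ∈ ball hn s a := mem_ball.2 ⟨t, hts, rfl⟩
  have hx3 : (a * gen hn t).1 (trd hn) = c.1 s := (mul_gen_apply_trd a t).trans ht
  have hxs := apply_of_mem_ball hs hxb
  set x := a * gen hn t with hx
  obtain ⟨hys, hy3⟩ := mul_gen_apply (hn := hn) x hs
  rw [hx3] at hys
  rw [hxs] at hy3
  set y := x * gen hn s with hy
  by_cases hxF : x ∈ F ∨ y ∈ F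
  · exact hextra x (fun h => (htrd x h).2 hx3) (Or.inl hxs) (fun h => (htrd y h).1 hy3) hxF
  push Not at hxF
  have hay : Linked (alternatingGroupNetwork n hn) F a y :=
    (linked_of_mem_ball hxb ha.1 hxF.1).trans (linked_mul_gen hxF.1 hxF.2)
  have hyc : (ball hn s y ∩ ball hn s c).card ≤ 1 :=
    card_ball_inter_le hxF.2 hc.1 fun h => hac (hay.trans h)
  -- Now `y` is in the component of `a`, hence stuck and unlinked from `c`. Of its `n - 2`
  -- neighbours within the class, at most one lies near `c`; only `y` itself is matched back into
  -- the class of `a`.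
  obtain ⟨e, he, hec⟩ := Finset.exists_mem_notMem_of_card_lt_card
    (s := ball hn s y ∩ ball hn s c) (t := (ball hn s y).erase y) (by
      have h5 := Finset.pred_card_le_card_erase (s := ball hn s y) (a := y)
      rw [card_ball] at h5
      omega)
  rw [Finset.mem_erase] at he
  have hyb : y ∈ ball hn s y :=
    mem_ball.2 ⟨trd hn, fun h => hs (by simp [lead, ← h]), by rw [gen_trd, mul_one]⟩
  have hes : e.1 s = c.1 s := (apply_of_mem_ball hs he.2).trans hys
  have he3 : e.1 (trd hn) ≠ a.1 s := fun h =>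
    he.1 (eq_of_mem_ball he.2 hyb (h.trans hy3.symm))
  have he3' : e.1 (trd hn) ≠ c.1 s := hes ▸ apply_trd_ne hs e
  refine hextra e (fun h => ?_) (Or.inr hes) (fun h => ?_)
    ((ha.of_linked hay).mem_or_mem hs he.2 (hsp _ he3 he3'))
  · rcases Finset.mem_union.1 h with h | h
    · exact hc_ne (hes.symm.trans (hAs e h))
    · exact hec (Finset.mem_inter.2 ⟨he.2, (Finset.mem_filter.1 h).1⟩)
  · have h' := hs_or _ h
    rw [(mul_gen_apply e hs).1] at h'
    exact h'.elim he3 he3'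

/-- Stuck vertices lie in dense classes. Three distinct dense classes would need too many deletions,
so two of the vertices share a class. -/
theorem card_ge_of_stuck {hn : 3 ≤ n} (hn6 : 6 ≤ n) {s : Fin n} (hs : s ∉ lead hn)
    {F : Finset (alternatingGroup (Fin n))} {a b c : alternatingGroup (Fin n)}
    (ha : Stuck hn s F a) (hb : Stuck hn s F b) (hc : Stuck hn s F c)
    (hab : ¬ Linked (alternatingGroupNetwork n hn) F a b)
    (hac : ¬ Linked (alternatingGroupNetwork n hn) F a c)
    (hbc : ¬ Linked (alternatingGroupNetwork n hn) F b c) : 3 * n - 6 ≤ F.card := by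
  by_cases h1 : b.1 s = a.1 s
  · by_cases h2 : c.1 s = a.1 s
    · exact card_ge_of_stuck_of_eq hn6 hs ha hb hc hab hac hbc h1 h2
    · exact card_ge_of_stuck_of_ne hn6 hs ha hb hc hab hac h1 h2
  · by_cases h2 : c.1 s = a.1 s
    · exact card_ge_of_stuck_of_ne hn6 hs ha hc hb hac hab h2 h1
    by_cases h3 : c.1 s = b.1 s
    · exact card_ge_of_stuck_of_ne hn6 hs hb hc ha hbc (fun h => hab h.symm) h3 (Ne.symm h1)
    by_contra hlt
    exact hc.not_sparse (sparse_of_ne hn (by omega) ha.not_sparse hb.not_sparse (Ne.symm h1) h2 h3)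

/-! ### Counting components -/

theorem card_connectedComponent_le (hn : 3 ≤ n) (hn6 : 6 ≤ n)
    (F : Finset (alternatingGroup (Fin n))) (hF : F.card ≤ 3 * n - 7) :
    Nat.card ((alternatingGroupNetwork n hn).induce {v | v ∉ F}).ConnectedComponent ≤ 3 := by
  classical
  by_contra hlt
  push Not at hlt
  set H := (alternatingGroupNetwork n hn).induce {v | v ∉ F} with hH
  let _ := Fintype.ofFinite H.ConnectedComponent
  rw [Nat.card_eq_fintype_card, ← Finset.card_univ] at hlt
  let s : Fin n := ⟨3, by omega⟩
  have hs : s ∉ lead hn := by simp [mem_lead, s, fst, snd, trd]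
  have hmk : ∀ p q : {v | v ∉ F}, H.connectedComponentMk p = H.connectedComponentMk q ↔
      Linked (alternatingGroupNetwork n hn) F p.1 q.1 := fun p q =>
    SimpleGraph.ConnectedComponent.eq.trans ⟨fun h => ⟨p.2, q.2, h⟩, fun h => h.2.2⟩
  -- At most one component meets a sparse class, so four components would leave three stuck ones.
  set K := Finset.univ.filter fun k : H.ConnectedComponent =>
    ∃ p : {v | v ∉ F}, H.connectedComponentMk p = k ∧ Sparse s F (p.1.1 s)
  have hK : K.card ≤ 1 := by
    refine Finset.card_le_one.2 fun k hk l hl => ?_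
    obtain ⟨-, p, rfl, hp⟩ := Finset.mem_filter.1 hk
    obtain ⟨-, q, rfl, hq⟩ := Finset.mem_filter.1 hl
    exact (hmk p q).2 (linked_of_sparse hn6 hs hF p.2 q.2 hp hq)
  have hstuck : ∀ p : {v | v ∉ F}, H.connectedComponentMk p ∈ Kᶜ → Stuck hn s F p.1 := by
    intro p hp
    refine ⟨p.2, fun q hq hl => ?_⟩
    rw [Finset.mem_compl] at hp
    exact hp (Finset.mem_filter.2 ⟨Finset.mem_univ _, ⟨q, hl.2.1⟩, (hmk _ _).2 hl.symm, hq⟩)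
  have h2 : 2 < Kᶜ.card := by
    rw [Finset.card_compl, ← Finset.card_univ]
    omega
  obtain ⟨k, l, m, hk, hl, hm, hkl, hkm, hlm⟩ := Finset.two_lt_card_iff.1 h2
  obtain ⟨a, rfl⟩ := k.exists_rep
  obtain ⟨b, rfl⟩ := l.exists_rep
  obtain ⟨c, rfl⟩ := m.exists_rep
  have := card_ge_of_stuck hn6 hs (hstuck a hk) (hstuck b hl) (hstuck c hm)
    (fun h => hkl ((hmk a b).2 h)) (fun h => hkm ((hmk a c).2 h)) (fun h => hlm ((hmk b c).2 h))
  omega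

end AlternatingNetwork

open AlternatingNetwork in
theorem lemma3p2 (n : ℕ) (hn : 6 ≤ n) :
    3 * n - 6 ≤ componentConnectivity 4 (alternatingGroupNetwork n (le_trans (by norm_num) hn)) ∧
    ∀ F : Finset (alternatingGroup (Fin n)), F.card ≤ 3 * n - 7 →
      Nat.card ((alternatingGroupNetwork n (le_trans (by norm_num) hn)).induce
        {v | v ∉ F}).ConnectedComponent ≤ 3 := by
  refine ⟨?_, card_connectedComponent_le _ hn⟩
  obtain ⟨F, hFcard, hF⟩ := componentConnectivity_attained (ℓ := 4) (by norm_num)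
    (alternatingGroupNetwork n (le_trans (by norm_num) hn))
  rw [← hFcard]
  by_contra hlt
  rcases hF with ⟨-, h4⟩ | h4
  · have := card_connectedComponent_le (le_trans (by norm_num) hn) hn F (by omega)
    omega
  -- Too few survivors is impossible: of at least `3n` vertices, at most `3n - 7` are deleted.
  · have h1 := card_alternatingGroup_ge (β := Fin n) (by rw [Fintype.card_fin]; omega)
    rw [Fintype.card_fin] at h1
    have h2 : Nat.card {v : alternatingGroup (Fin n) | v ∉ F} =
        Fintype.card (alternatingGroup (Fin n)) - F.card := by
      have h3 : {v : alternatingGroup (Fin n) | v ∉ F} = (Fᶜ : Finset _) := by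
        ext v; simp
      rw [h3, ← Finset.card_compl]
      exact Nat.card_eq_finsetCard _
    omega
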